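/- There are a function $q\mapsto\beta^*_q$ on $[1,\infty)$ and absolute constants $c_1,c_2,C>0$ such that for every real $q\ge 1$ $$\frac{c_1}{q\ln(q+1)}\le \beta^*_q\le \frac{c_2}{q\ln(q+1)},\qquad \beta^*_q<1,$$ and the following holds. Let $(X,d)$ be a finite metric space, let $r,R>0$ satisfy $\beta:=r/R\le\beta^*_q$, and put $D_\beta=2(q+1)\ln(1/\beta)$. Write $\operatorname{Ball}(u,l)=\{v\in X: d(u,v)\le l\}$ and $x^+=\max(x,0)$. Then there is a random partition $\mathcal P$ of $X$ (that is, a probability distribution on the partitions of $X$; $\mathcal P(u)$ denotes the cluster containing $u$) such that: (1) always (for every partition of positive probability), every cluster $P\in\mathcal P$ has $\operatorname{diam}(P)\le 2R$; (2) for every $u\in X$, $$\sum_{v\in\operatorname{Ball}(u,R)}\Big(\Pr\{\mathcal P(u)\ne\mathcal P(v)\}-D_\beta\frac{d(u,v)}{R}\Big)^+\le C\,\beta^q\sum_{v\in\operatorname{Ball}(u,2R)}\frac{d(u,v)}{R};$$ (3) always (for every partition of positive probability), for every $u\in X$, $$\sum_{v\in\operatorname{Ball}(u,r)}\mathbf 1\{\mathcal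 P(u)\ne\mathcal P(v)\}\le C\,\beta D_\beta^2\sum_{v\in\operatorname{Ball}(u,2R)}\frac{d(u,v)}{R}.$$ -/

import Mathlib

/-- `finBall u l` is the closed ball `{v : d(u, v) ≤ l}` of a finite metric space, as a finset. -/
noncomputable def finBall {X : Type*} [Fintype X] [MetricSpace X] (u : X) (l : ℝ) : Finset X :=
  Finset.univ.filter fun v => dist u v ≤ l

/-- A partition of the whole (finite) space `X` into non-empty clusters. -/
abbrev Clustering (X : Type*) [Fintype X] [DecidableEq X] :=
  Finpartition (Finset.univ : Finset X)

/-- `P` separates `u` and `v`: the cluster of `P` containing `u` is not the one containing `v`. -/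
def Separates {X : Type*} [Fintype X] [DecidableEq X] (P : Clustering X) (u v : X) : Prop :=
  P.part u ≠ P.part v

/-- The probability that a random partition with law `μ` separates `u` and `v`. The set of
partitions is finite and every event is measurable, so this is the total mass of the event. -/
noncomputable def separationProb {X : Type*} [Fintype X] [DecidableEq X]
    (μ : PMF (Clustering X)) (u v : X) : ℝ :=
  (μ.toOuterMeasure {P | Separates P u v}).toReal

/-- `D_β = 2 (q + 1) ln (1 / β)`. -/
noncomputable def sepCoeff (q β : ℝ) : ℝ :=
  2 * (q + 1) * Real.log (1 / β)

/-! Write β = r/R, D = D_β, η = β^q, and let A(u) be the normalised distance sum over the 2R-ball of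
u in the whole space. Call u heavy in a remaining set U if its R/D-ball in U has more than ηA(u)
points. While heavy points exist, take the z with the largest R/D-ball and carve its ball of a
random radius t in [3R/D, R - r]; light leftovers become singletons. At a light point all errors
within R/D are paid for by ηA(u).

Radii. Points at distance between R/D and 2R from z weigh at least 1/D each in A(z), so heaviness
forces the R-ball of z to be at most e^{D/2} = β^{-(q+1)} times its R/D-ball. By averaging
log-cardinality, a set S of radii of measure at least R/2 has r-annuli of relative size O(βD). The
radius has a truncated exponential law of rate D/R on S (`exists_radius_law`).

Average bound. By memorylessness, a step separates u, v with probability at most D d(u,v)/R times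
(the chance that it captures u or v, plus 2e^{-D/2}). The capture chances add up to at most 1 over
the process, giving the permitted linear term. The truncation error is charged to the core, the
R/D-ball of z: the core leaves U, lies at distance at least R/D from u, and by maximality of z
outnumbers the near neighbours of u.

Worst case. Pairs cut at u lie in a sparse annulus, of size O(βD) times the cluster; the core
argument bounds the cluster by 2D times its own distance mass around u. Clusters are disjoint, so
both charges telescope (`IsLocalLabelling.carve`). -/

/-! ### Truncated exponential laws on a set of radii. -/

/-- The elements of a finite set of reals, listed in increasing order. -/
theorem exists_strictMonoOn_enumeration (T : Finset ℝ) (hT : T.Nonempty) :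
    ∃ (n : ℕ) (τ : ℕ → ℝ), (∀ i j, i < j → j ≤ n → τ i < τ j) ∧
      ∀ x ∈ T, ∃ i ≤ n, τ i = x := by
  have hc : 0 < T.card := hT.card_pos
  refine ⟨T.card - 1, fun i => if h : i < T.card then T.orderEmbOfFin rfl ⟨i, h⟩ else 0, ?_, ?_⟩
  · intro i j hij hj
    have h1 : i < T.card := by omega
    have h2 : j < T.card := by omega
    simp only [h1, h2, dif_pos]
    exact (T.orderEmbOfFin rfl).strictMono hij
  · intro x hx
    have : x ∈ Set.range (T.orderEmbOfFin rfl) := by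
      rw [Finset.range_orderEmbOfFin]; exact hx
    obtain ⟨⟨i, hi⟩, rfl⟩ := this
    exact ⟨i, by omega, by simp [hi]⟩

/-- A truncated exponential law for the parameter `s t`, where `s` is a `1`-Lipschitz monotone
clock that only advances at the points of `S`: a finitely supported random `t ∈ S`, exact at the
breakpoints in `T`. -/
theorem exists_truncated_exponential_of_clock (T : Finset ℝ) (S : Set ℝ) (a b lam L : ℝ)
    (s : ℝ → ℝ) (hlam : 0 < lam) (hL : 0 < L) (hs : Monotone s)
    (hlip : ∀ x y, x ≤ y → s y ≤ s x + (y - x))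
    (ha : ∀ x ≤ a, s x = 0) (hb : ∀ x, b ≤ x → s x = L)
    (hgap : ∀ x y, s x < s y → ∃ t ∈ S, x ≤ t ∧ t < y) :
    ∃ (I : Finset ℕ) (p t : ℕ → ℝ), (∀ i ∈ I, 0 < p i) ∧ (∀ i ∈ I, t i ∈ S) ∧
      ∑ i ∈ I, p i = 1 ∧ ∀ x ∈ T, ∀ y ∈ T, x ≤ y →
        ∑ i ∈ I with x ≤ t i ∧ t i < y, p i ≤
          lam * (y - x) * (∑ i ∈ I with x ≤ t i, p i +
            Real.exp (-(lam * L)) / (1 - Real.exp (-(lam * L)))) := by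
  -- Including a and b makes the clock read 0 at the first breakpoint and L at the last.
  obtain ⟨n, τ, hτ, hT⟩ := exists_strictMonoOn_enumeration (T ∪ {a, b}) ⟨a, by simp⟩
  set ε := Real.exp (-(lam * L)) with hε
  have hε1 : 0 < 1 - ε := by
    have : ε < 1 := by rw [hε, Real.exp_lt_one_iff]; nlinarith
    linarith
  have hτ' : ∀ i j, i ≤ j → j ≤ n → τ i ≤ τ j := fun i j hij hj => by
    rcases hij.eq_or_lt with rfl | h
    · exact le_rfl
    · exact (hτ i j h hj).le
  obtain ⟨ia, hia, hia'⟩ := hT a (by simp)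
  obtain ⟨ib, hib, hib'⟩ := hT b (by simp)
  have hs0 : s (τ 0) = 0 := ha _ (hia' ▸ hτ' 0 ia (Nat.zero_le _) hia)
  have hsn : s (τ n) = L := hb _ (hib' ▸ hτ' ib n hib le_rfl)
  -- Untruncated survival function at the breakpoints; each interval on which the clock advances
  -- gets one atom carrying the normalised drop of g.
  let g : ℕ → ℝ := fun i => Real.exp (-(lam * s (τ i)))
  let p : ℕ → ℝ := fun i => (g i - g (i + 1)) / (1 - ε)
  let I : Finset ℕ := (Finset.range n).filter fun i => s (τ i) < s (τ (i + 1))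
  have hch : ∀ i, ∃ t, i ∈ I → t ∈ S ∧ τ i ≤ t ∧ t < τ (i + 1) := fun i => by
    by_cases hi : i ∈ I
    · obtain ⟨t, h1, h2, h3⟩ := hgap _ _ (Finset.mem_filter.1 hi).2
      exact ⟨t, fun _ => ⟨h1, h2, h3⟩⟩
    · exact ⟨0, fun h => absurd h hi⟩
  choose t ht using hch
  have hple : ∀ i < n, i ∉ I → p i = 0 := by
    intro i hi hiI
    have h1 : s (τ i) ≤ s (τ (i + 1)) := hs (hτ' _ _ (by omega) (by omega))
    have h2 : s (τ i) = s (τ (i + 1)) := by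
      refine le_antisymm h1 (not_lt.1 fun h => hiI ?_)
      exact Finset.mem_filter.2 ⟨Finset.mem_range.2 hi, h⟩
    simp [p, g, h2]
  have hle_iff : ∀ i ∈ I, ∀ k ≤ n, (τ k ≤ t i ↔ k ≤ i) := by
    intro i hi k hk
    have hin : i < n := Finset.mem_range.1 (Finset.mem_filter.1 hi).1
    constructor
    · intro h
      by_contra hlt
      have := hτ' (i + 1) k (by omega) hk
      linarith [(ht i hi).2.2]
    · intro h
      exact (hτ' k i h hin.le).trans (ht i hi).2.1
  have hsum : ∀ k m, k ≤ m → m ≤ n →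
      ∑ i ∈ I with k ≤ i ∧ i < m, p i = (g k - g m) / (1 - ε) := by
    intro k m hkm hm
    have h1 : ∑ i ∈ I with k ≤ i ∧ i < m, p i = ∑ i ∈ Finset.Ico k m, p i := by
      apply Finset.sum_subset
      · intro i hi
        simp only [Finset.mem_filter] at hi
        exact Finset.mem_Ico.2 hi.2
      · intro i hi hi'
        rw [Finset.mem_Ico] at hi
        apply hple i (by omega)
        intro hI
        exact hi' (Finset.mem_filter.2 ⟨hI, hi⟩)
    rw [h1, Finset.sum_Ico_eq_sum_range, ← Finset.sum_div]
    congr 1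
    have := Finset.sum_range_sub' (fun i => g (k + i)) (m - k)
    simp only [Nat.add_zero, Nat.add_sub_cancel' hkm] at this
    rw [← this]
    rfl
  have hgn : g n = ε := by simp only [g, hsn, hε]
  have hg0 : g 0 = 1 := by simp [g, hs0]
  refine ⟨I, p, t, ?_, fun i hi => (ht i hi).1, ?_, ?_⟩
  · intro i hi
    apply div_pos _ hε1
    have := (Finset.mem_filter.1 hi).2
    have : g (i + 1) < g i := Real.exp_lt_exp.2 (by nlinarith)
    linarith
  · have h := hsum 0 n (Nat.zero_le _) le_rfl
    rw [hg0, hgn, div_self hε1.ne'] at h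
    rw [← h]
    refine Finset.sum_congr ?_ fun _ _ => rfl
    rw [Finset.filter_true_of_mem]
    intro i hi
    exact ⟨Nat.zero_le _, Finset.mem_range.1 (Finset.mem_filter.1 hi).1⟩
  · intro x hx y hy hxy
    obtain ⟨k, hk, rfl⟩ := hT x (by simp [hx])
    obtain ⟨m, hm, rfl⟩ := hT y (by simp [hy])
    have hkm : k ≤ m := by
      by_contra h
      exact absurd (hτ m k (by omega) hk) (not_lt.2 hxy)
    have e1 : ∑ i ∈ I with τ k ≤ t i ∧ t i < τ m, p i = (g k - g m) / (1 - ε) := by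
      rw [← hsum k m hkm hm]
      refine Finset.sum_congr (Finset.filter_congr fun i hi => ?_) fun _ _ => rfl
      rw [hle_iff i hi k hk, ← not_le, hle_iff i hi m hm, not_le]
    have e2 : ∑ i ∈ I with τ k ≤ t i, p i = (g k - g n) / (1 - ε) := by
      rw [← hsum k n hk le_rfl]
      refine Finset.sum_congr (Finset.filter_congr fun i hi => ?_) fun _ _ => rfl
      rw [hle_iff i hi k hk]
      exact ⟨fun h => ⟨h, Finset.mem_range.1 (Finset.mem_filter.1 hi).1⟩, fun h => h.1⟩
    -- The correction ε/(1 - ε) restores the tail removed by truncation, so the bracket is g k/(1 -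
    -- ε) and the exact memoryless estimate applies.
    rw [e1, e2, hgn, ← add_div, sub_add_cancel, ← mul_div_assoc]
    gcongr
    have hg : g m = g k * Real.exp (-(lam * (s (τ m) - s (τ k)))) := by
      simp only [g, ← Real.exp_add]; ring_nf
    have hexp := Real.add_one_le_exp (-(lam * (s (τ m) - s (τ k))))
    have hgk : 0 < g k := Real.exp_pos _
    have hl := hlip _ _ hxy
    have h3 : lam * (s (τ m) - s (τ k)) ≤ lam * (τ m - τ k) := by
      apply mul_le_mul_of_nonneg_left _ hlam.le; linarith
    rw [hg]
    nlinarith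

open MeasureTheory in
/-- A truncated exponential law of rate `lam` on a set `S` of radii. -/
theorem exists_truncated_exponential (T : Finset ℝ) (S : Set ℝ) (a b lam : ℝ)
    (hlam : 0 < lam) (hSab : S ⊆ Set.Ico a b) (hS : 0 < volume.real S) :
    ∃ (I : Finset ℕ) (p t : ℕ → ℝ), (∀ i ∈ I, 0 < p i) ∧ (∀ i ∈ I, t i ∈ S) ∧
      ∑ i ∈ I, p i = 1 ∧ ∀ x ∈ T, ∀ y ∈ T, x ≤ y →
        ∑ i ∈ I with x ≤ t i ∧ t i < y, p i ≤
          lam * (y - x) * (∑ i ∈ I with x ≤ t i, p i +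
            Real.exp (-(lam * volume.real S)) / (1 - Real.exp (-(lam * volume.real S)))) := by
  have hfin : ∀ A : Set ℝ, volume (S ∩ A) ≠ ⊤ := fun A =>
    measure_ne_top_of_subset (Set.inter_subset_left.trans hSab) (by simp)
  have hlip : ∀ x y, x ≤ y →
      volume.real (S ∩ Set.Iio y) ≤ volume.real (S ∩ Set.Iio x) + volume.real (S ∩ Set.Ico x y) := by
    intro x y hxy
    refine le_trans (measureReal_mono ?_ ?_) (measureReal_union_le _ _)
    · rw [← Set.inter_union_distrib_left, Set.Iio_union_Ico_eq_Iio hxy]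
    · rw [← Set.inter_union_distrib_left]; exact hfin _
  -- The clock is the measure of S to the left of x.
  refine exists_truncated_exponential_of_clock T S a b lam (volume.real S)
    (fun x => volume.real (S ∩ Set.Iio x)) hlam hS ?_ ?_ ?_ ?_ ?_
  · intro x y hxy
    exact measureReal_mono (Set.inter_subset_inter_right _ (Set.Iio_subset_Iio hxy)) (hfin _)
  · intro x y hxy
    refine (hlip x y hxy).trans (add_le_add le_rfl ?_)
    refine (measureReal_mono Set.inter_subset_right (by simp)).trans ?_
    rw [Real.volume_real_Ico_of_le hxy]
  · intro x hx
    have : S ∩ Set.Iio x = ∅ := by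
      ext t
      simp only [Set.mem_inter_iff, Set.mem_Iio, Set.mem_empty_iff_false, iff_false, not_and, not_lt]
      exact fun h => hx.trans (hSab h).1
    simp [this]
  · intro x hx
    have : S ∩ Set.Iio x = S := Set.inter_eq_left.2 fun t h => (hSab h).2.trans_le hx
    simp [this]
  · intro x y hxy
    have hxy' : x ≤ y := by
      by_contra h
      refine absurd hxy (not_lt.2 ?_)
      exact measureReal_mono (Set.inter_subset_inter_right _ (Set.Iio_subset_Iio (not_le.1 h).le))
        (hfin _)
    have hpos : volume.real (S ∩ Set.Ico x y) ≠ 0 := by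
      have := hlip x y hxy'
      intro h0
      linarith
    have hne : (S ∩ Set.Ico x y).Nonempty := by
      by_contra h
      rw [Set.not_nonempty_iff_eq_empty] at h
      simp [h] at hpos
    obtain ⟨t, h1, h2⟩ := hne
    exact ⟨t, h1, h2.1, h2.2⟩

/-! ### Radii with sparse annuli. -/

open MeasureTheory in
/-- A monotone function of bounded total increase has a small increment over a window of
half-width `r` around most points. -/
theorem volume_window_increment_le (f : ℝ → ℝ) (hf : Monotone f) (a b r θ V : ℝ) (hab : a ≤ b)
    (hr : 0 < r) (hθ : 0 < θ) (hV : f (b + r) - f (a - r) ≤ V) :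
    b - a - 2 * r * V / θ ≤
      volume.real {t | t ∈ Set.Ioc a b ∧ f (t + r) - f (t - r) ≤ θ} := by
  have hint : ∀ x y, IntervalIntegrable f volume x y := fun x y => hf.intervalIntegrable
  have hp : Monotone fun t => f (t + r) := fun x y h => hf (by linarith)
  have hm : Monotone fun t => f (t - r) := fun x y h => hf (by linarith)
  have hintp : IntervalIntegrable (fun t => f (t + r)) volume a b := hp.intervalIntegrable
  have hintm : IntervalIntegrable (fun t => f (t - r)) volume a b := hm.intervalIntegrable
  -- The two shifted integrals cancel except on end windows of length 2r, where monotonicity bounds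
  -- f by its extreme values. Markov's inequality then bounds the bad set.
  have hI : ∫ t in a..b, (f (t + r) - f (t - r)) ≤ 2 * r * V := by
    rw [intervalIntegral.integral_sub hintp hintm,
      intervalIntegral.integral_comp_add_right, intervalIntegral.integral_comp_sub_right]
    have h1 := intervalIntegral.integral_add_adjacent_intervals
      (hint (a - r) (a + r)) (hint (a + r) (b + r))
    have h2 := intervalIntegral.integral_add_adjacent_intervals
      (hint (a - r) (b - r)) (hint (b - r) (b + r))
    have h3 : ∫ t in (b - r)..(b + r), f t ≤ ∫ _ in (b - r)..(b + r), f (b + r) :=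
      intervalIntegral.integral_mono_on (by linarith) (hint _ _) (by simp) fun x hx => hf hx.2
    have h4 : ∫ _ in (a - r)..(a + r), f (a - r) ≤ ∫ t in (a - r)..(a + r), f t :=
      intervalIntegral.integral_mono_on (by linarith) (by simp) (hint _ _) fun x hx => hf hx.1
    simp only [intervalIntegral.integral_const, smul_eq_mul] at h3 h4
    nlinarith
  set G := {t | t ∈ Set.Ioc a b ∧ f (t + r) - f (t - r) ≤ θ} with hG
  set B := {t | t ∈ Set.Ioc a b ∧ θ < f (t + r) - f (t - r)} with hB
  have hB1 : θ * volume.real B ≤ 2 * r * V := by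
    refine le_trans ?_ hI
    rw [intervalIntegral.integral_of_le hab]
    have hnn : 0 ≤ᵐ[volume.restrict (Set.Ioc a b)] fun t => f (t + r) - f (t - r) :=
      Filter.Eventually.of_forall fun t => sub_nonneg.2 (hf (by linarith))
    have hmk := mul_meas_ge_le_integral_of_nonneg hnn (hintp.sub hintm).1 θ
    refine le_trans (mul_le_mul_of_nonneg_left ?_ hθ.le) hmk
    rw [measureReal_restrict_apply' measurableSet_Ioc]
    refine measureReal_mono ?_ 
      (measure_ne_top_of_subset (μ := volume) Set.inter_subset_right measure_Ioc_lt_top.ne)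
    exact fun t ht => ⟨ht.2.le, ht.1⟩
  have hGB : b - a ≤ volume.real G + volume.real B := by
    rw [← Real.volume_real_Ioc_of_le hab]
    refine le_trans (measureReal_mono (s₂ := G ∪ B) ?_ ?_) (measureReal_union_le _ _)
    · intro t ht
      rcases le_or_gt (f (t + r) - f (t - r)) θ with h | h
      · exact Or.inl ⟨ht, h⟩
      · exact Or.inr ⟨ht, h⟩
    · refine measure_ne_top_of_subset (μ := volume) ?_ (measure_Ioc_lt_top (a := a) (b := b)).ne
      rintro t (h | h) <;> exact h.1
  have : volume.real B ≤ 2 * r * V / θ := by rw [le_div_iff₀ hθ]; linarith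
  linarith

open MeasureTheory in
/-- Around a centre `z` with bounded growth between the radii `R / D` and `R`, a random radius that
cuts only sparse annuli and separates each pair with probability controlled by its distance. -/
theorem exists_radius_law {X : Type*} [MetricSpace X] (U : Finset X) (z : X) (hz : z ∈ U)
    (R r D : ℝ) (hR : 0 < R) (hr : 0 < r) (hD : 16 ≤ D) (hrD : r / R * D ≤ 1 / 8)
    (hgrow : ((U.filter fun v => dist z v ≤ R).card : ℝ) ≤
      Real.exp (D / 2) * (U.filter fun v => dist z v ≤ R / D).card) :
    ∃ (I : Finset ℕ) (p t : ℕ → ℝ), (∀ i ∈ I, 0 < p i) ∧ ∑ i ∈ I, p i = 1 ∧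
      (∀ i ∈ I, 3 * (R / D) ≤ t i ∧ t i ≤ R - r ∧
        ((U.filter fun v => dist z v ≤ t i + r).card : ℝ) -
          (U.filter fun v => dist z v ≤ t i - r).card ≤
            8 * (r / R * D) * (U.filter fun v => dist z v ≤ t i).card) ∧
      ∀ u ∈ U, ∀ v ∈ U,
        ∑ i ∈ I with ¬(dist z u ≤ t i ↔ dist z v ≤ t i), p i ≤
          D / R * dist u v * (∑ i ∈ I with dist z u ≤ t i ∨ dist z v ≤ t i, p i +
            2 * Real.exp (-(D / 2))) := by
  set N : ℝ → ℕ := fun x => (U.filter fun v => dist z v ≤ x).card with hN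
  have hNmono : Monotone N := fun x y hxy =>
    Finset.card_le_card (Finset.monotone_filter_right _ fun v _ h => le_trans h hxy)
  have hD0 : 0 < D := by linarith
  have hρ : 0 < R / D := by positivity
  have hN1 : ∀ x, 0 ≤ x → (1 : ℝ) ≤ N x := fun x hx => by
    have : 0 < N x := Finset.card_pos.2 ⟨z, by simp [hz, hx]⟩
    exact_mod_cast this
  have hf : Monotone fun x => Real.log (N x) := by
    intro x y hxy
    rcases Nat.eq_zero_or_pos (N x) with h | h
    · simpa [h] using Real.log_natCast_nonneg (N y)
    · exact Real.log_le_log (by exact_mod_cast h) (by exact_mod_cast hNmono hxy)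
  have hrR : r * D ≤ R / 8 := by
    rw [div_mul_eq_mul_div, div_le_iff₀ hR] at hrD; linarith
  have hρD : R / D * D = R := by field_simp
  have hr16 : r ≤ R / 128 := by nlinarith
  have hrρ : r ≤ R / D := by rw [le_div_iff₀ hD0]; linarith
  have hρ16 : R / D ≤ R / 16 := by gcongr
  have hθ : 0 < 4 * (r / R * D) := by positivity
  have hV : Real.log (N (R - r + r)) - Real.log (N (3 * (R / D) - r)) ≤ D / 2 := by
    rw [sub_add_cancel, sub_le_iff_le_add]
    have h1 := hN1 (3 * (R / D) - r) (by linarith)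
    have h2 : (N (R / D) : ℝ) ≤ N (3 * (R / D) - r) := by exact_mod_cast hNmono (by linarith)
    rw [← Real.log_exp (D / 2), ← Real.log_mul (Real.exp_pos _).ne' (by linarith)]
    apply Real.log_le_log
    · linarith [hN1 R hR.le]
    · refine hgrow.trans ?_
      gcongr
  have hvol := volume_window_increment_le (fun x => Real.log (N x)) hf (3 * (R / D)) (R - r) r
    (4 * (r / R * D)) (D / 2) (by linarith) hr hθ hV
  set S := {t | t ∈ Set.Ioc (3 * (R / D)) (R - r) ∧
    Real.log (N (t + r)) - Real.log (N (t - r)) ≤ 4 * (r / R * D)} with hS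
  -- The threshold 4βD makes the bad radii have measure at most R/4; 3R/D ≤ 3R/16 and r ≤ R/128
  -- leave more than R/2.
  have hVS : R / 2 ≤ volume.real S := by
    have : 2 * r * (D / 2) / (4 * (r / R * D)) = R / 4 := by field_simp
    linarith
  obtain ⟨I, p, t, hp, htS, hsum, hsep⟩ := exists_truncated_exponential
    -- The +1 only turns the closed right end of S into a half-open one; the estimate depends on the
    -- measure of S alone.
    (U.image (dist z)) S (3 * (R / D)) (R - r + 1) (D / R) (by positivity)
    (fun t ht => ⟨ht.1.1.le, by linarith [ht.1.2]⟩) (by linarith)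
  refine ⟨I, p, t, hp, hsum, ?_, ?_⟩
  · intro i hi
    obtain ⟨⟨h1, h2⟩, h3⟩ := htS i hi
    refine ⟨h1.le, h2, ?_⟩
    have hp1 := hN1 (t i + r) (by linarith)
    have hm1 := hN1 (t i - r) (by linarith)
    have h4 : (N (t i + r) : ℝ) ≤ Real.exp (4 * (r / R * D)) * N (t i - r) := by
      rw [sub_le_iff_le_add, ← Real.log_exp (4 * (r / R * D)),
        ← Real.log_mul (Real.exp_pos _).ne' (by linarith),
        Real.log_le_log_iff (by linarith) (by positivity)] at h3
      exact h3
    have h5 := (abs_le.1 (Real.abs_exp_sub_one_le (x := 4 * (r / R * D))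
      (by rw [abs_of_pos hθ]; linarith))).2
    rw [abs_of_pos hθ] at h5
    have h6 : (N (t i - r) : ℝ) ≤ N (t i) := by exact_mod_cast hNmono (by linarith)
    calc (N (t i + r) : ℝ) - N (t i - r)
        ≤ (Real.exp (4 * (r / R * D)) - 1) * N (t i - r) := by linarith
      _ ≤ (2 * (4 * (r / R * D))) * N (t i) := by gcongr
      _ = _ := by ring
  · have hε : Real.exp (-(D / R * volume.real S)) ≤ Real.exp (-(D / 2)) := by
      apply Real.exp_le_exp.2
      have : D / R * (R / 2) ≤ D / R * volume.real S := by gcongr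
      have h2 : D / R * (R / 2) = D / 2 := by field_simp
      linarith
    have hhalf : Real.exp (-(D / 2)) ≤ 1 / 2 := by
      have h1 := Real.add_one_le_exp (D / 2)
      rw [Real.exp_neg, inv_eq_one_div]
      gcongr
      linarith
    have hε' : Real.exp (-(D / R * volume.real S)) / (1 - Real.exp (-(D / R * volume.real S))) ≤
        2 * Real.exp (-(D / 2)) := by
      rw [div_le_iff₀ (by linarith)]
      nlinarith [Real.exp_pos (-(D / 2))]
    have key : ∀ u ∈ U, ∀ v ∈ U, dist z u ≤ dist z v →
        ∑ i ∈ I with ¬(dist z u ≤ t i ↔ dist z v ≤ t i), p i ≤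
          D / R * dist u v * (∑ i ∈ I with dist z u ≤ t i ∨ dist z v ≤ t i, p i +
            2 * Real.exp (-(D / 2))) := by
      intro u hu v hv huv
      have h := hsep _ (Finset.mem_image_of_mem _ hu) _ (Finset.mem_image_of_mem _ hv) huv
      have e1 : (I.filter fun i => ¬(dist z u ≤ t i ↔ dist z v ≤ t i)) =
          I.filter fun i => dist z u ≤ t i ∧ t i < dist z v := by
        refine Finset.filter_congr fun i _ => ?_
        rw [← not_le]
        have := huv.trans (b := dist z v) (c := t i)
        tauto
      have e2 : (I.filter fun i => dist z u ≤ t i ∨ dist z v ≤ t i) =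
          I.filter fun i => dist z u ≤ t i := by
        refine Finset.filter_congr fun i _ => ?_
        have := huv.trans (b := dist z v) (c := t i)
        tauto
      rw [e1, e2]
      refine h.trans ?_
      have hd : dist z v - dist z u ≤ dist u v := by linarith [dist_triangle z u v]
      have hpos : 0 ≤ ∑ i ∈ I with dist z u ≤ t i, p i :=
        Finset.sum_nonneg fun i hi => (hp i (Finset.mem_filter.1 hi).1).le
      have hpos' : 0 ≤ Real.exp (-(D / R * volume.real S)) /
          (1 - Real.exp (-(D / R * volume.real S))) :=
        div_nonneg (Real.exp_pos _).le (by linarith)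
      gcongr
    intro u hu v hv
    rcases le_total (dist z u) (dist z v) with h | h
    · exact key u hu v hv h
    · have := key v hv u hu h
      rw [dist_comm u v]
      simpa only [or_comm, iff_comm (a := dist z v ≤ t _)] using this

/-! ### Distance mass and local labellings. -/

section Labelling

variable {X : Type*}

/-- The total weight of the labellings in the family `f` that separate `u` and `v`. -/
noncomputable def sepWeight [DecidableEq X] {ι : Type} [Fintype ι] (w : ι → ℝ) (f : ι → X → X) (u v : X) : ℝ :=
  ∑ i, if f i u ≠ f i v then w i else 0

theorem sepWeight_le_one [DecidableEq X] {ι : Type} [Fintype ι] {w : ι → ℝ} (hw : ∀ i, 0 < w i)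
    (h1 : ∑ i, w i = 1) (f : ι → X → X) (u v : X) : sepWeight w f u v ≤ 1 := by
  rw [← h1]
  refine Finset.sum_le_sum fun i _ => ?_
  split_ifs
  · exact le_rfl
  · exact (hw i).le

variable [MetricSpace X]

/-- The normalised first moment of the distance from `u`, over `U` within distance `2 R`. -/
noncomputable def distMass (R : ℝ) (U : Finset X) (u : X) : ℝ :=
  ∑ v ∈ U with dist u v ≤ 2 * R, dist u v / R

theorem distMass_nonneg {R : ℝ} (hR : 0 < R) (U : Finset X) (u : X) : 0 ≤ distMass R U u :=
  Finset.sum_nonneg fun _ _ => by positivity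

/-- Additivity lets a carving step pay with the mass of the removed cluster and recurse on the rest.
-/
theorem distMass_add_sdiff [DecidableEq X] (R : ℝ) {Q U : Finset X} (h : Q ⊆ U) (u : X) :
    distMass R Q u + distMass R (U \ Q) u = distMass R U u := by
  unfold distMass
  rw [Finset.sum_filter, Finset.sum_filter, Finset.sum_filter, add_comm, Finset.sum_sdiff h]

/-- Each point of W contributes at least 1/D to the mass. -/
theorem card_le_mul_distMass {R D : ℝ} (hR : 0 < R) (hD : 0 < D) (Q W : Finset X) (u : X)
    (hW : W ⊆ Q) (h : ∀ v ∈ W, R / D ≤ dist u v ∧ dist u v ≤ 2 * R) :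
    (W.card : ℝ) ≤ D * distMass R Q u := by
  have h1 : ∑ v ∈ W, D * (dist u v / R) ≤ D * distMass R Q u := by
    rw [← Finset.mul_sum]
    refine mul_le_mul_of_nonneg_left ?_ hD.le
    refine Finset.sum_le_sum_of_subset_of_nonneg ?_ fun _ _ _ => by positivity
    exact fun v hv => Finset.mem_filter.2 ⟨hW hv, (h v hv).2⟩
  refine le_trans ?_ h1
  rw [Finset.card_eq_sum_ones, Nat.cast_sum]
  refine Finset.sum_le_sum fun v hv => ?_
  have := (h v hv).1
  rw [div_le_iff₀ hD] at this
  rw [Nat.cast_one, ← mul_div_assoc, le_div_iff₀ hR]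
  linarith

end Labelling

/-- A random labelling of `U` (weights `w` on the labellings `f i`), labels being centres in `U`
at distance at most `R`, with the average and worst-case separation bounds relative to `U`. -/
structure IsLocalLabelling {X : Type*} [DecidableEq X] [MetricSpace X] (R r D η : ℝ) (A : X → ℝ)
    (U : Finset X) {ι : Type} [Fintype ι] (w : ι → ℝ) (f : ι → X → X) : Prop where
  pos : ∀ i, 0 < w i
  sum_eq : ∑ i, w i = 1
  mem : ∀ i, ∀ v ∈ U, f i v ∈ U
  dist_le : ∀ i, ∀ v ∈ U, dist (f i v) v ≤ R
  average : ∀ u ∈ U, ∑ v ∈ U with dist u v ≤ R / D,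
    max (sepWeight w f u v - D / R * dist u v) 0 ≤
      η * A u + 2 * Real.exp (-(D / 2)) * D * distMass R U u
  worst : ∀ i, ∀ u ∈ U, ((U.filter fun v => dist u v ≤ r ∧ f i u ≠ f i v).card : ℝ) ≤
    η * A u + 16 * (r / R * D) * D * distMass R U u

/-- Most of a ball cluster around a densest centre is far from a point `u` outside the core. -/
theorem card_cluster_le_mul_distMass {X : Type*} [MetricSpace X] {R r D : ℝ} (hR : 0 < R) (hr : 0 < r) (hD : 0 < D)
    (hrD : r ≤ R / D) (U : Finset X) (z u : X) (t : ℝ) (ht : 3 * (R / D) ≤ t) (htR : t ≤ R - r)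
    (hmax : (U.filter fun v => dist u v ≤ R / D).card ≤
      (U.filter fun v => dist z v ≤ R / D).card)
    (hut : t - r < dist z u) (hut' : dist z u ≤ t + r) :
    ((U.filter fun v => dist z v ≤ t).card : ℝ) ≤
      2 * (D * distMass R (U.filter fun v => dist z v ≤ t) u) := by
  set Q := U.filter fun v => dist z v ≤ t with hQ
  have hρ : 0 < R / D := by positivity
  have hfar := card_le_mul_distMass hR hD Q (Q.filter fun v => ¬ dist u v ≤ R / D) u
    (Finset.filter_subset _ _) fun v hv => by
      rw [Finset.mem_filter, hQ, Finset.mem_filter] at hv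
      refine ⟨(not_le.1 hv.2).le, ?_⟩
      linarith [dist_triangle_left u v z, hv.1.2]
  have h1 : (Q.filter fun v => dist u v ≤ R / D).card ≤
      (U.filter fun v => dist u v ≤ R / D).card :=
    Finset.card_le_card (Finset.filter_subset_filter _ (Finset.filter_subset _ _))
  have h2 : (U.filter fun v => dist z v ≤ R / D).card ≤
      (Q.filter fun v => ¬ dist u v ≤ R / D).card := by
    refine Finset.card_le_card fun v hv => ?_
    rw [Finset.mem_filter] at hv
    refine Finset.mem_filter.2 ⟨Finset.mem_filter.2 ⟨hv.1, by linarith [hv.2]⟩, ?_⟩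
    rw [not_le]
    linarith [dist_triangle_right z u v, hv.2]
  have h3 := Finset.card_filter_add_card_filter_not (s := Q) fun v => dist u v ≤ R / D
  have h4 : (Q.card : ℝ) ≤ 2 * (Q.filter fun v => ¬ dist u v ≤ R / D).card := by
    exact_mod_cast (by omega : Q.card ≤ 2 * (Q.filter fun v => ¬ dist u v ≤ R / D).card)
  linarith

/-! ### One carving step and the recursion. -/

section Step

variable {X : Type*} [DecidableEq X] [MetricSpace X]

theorem sum_max_sepWeight_le_card {R D : ℝ} (hR : 0 < R) (hD : 0 < D) {ι : Type} [Fintype ι]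
    {w : ι → ℝ} (hw : ∀ i, 0 < w i) (h1 : ∑ i, w i = 1) (f : ι → X → X) (s : Finset X) (u : X) :
    ∑ v ∈ s, max (sepWeight w f u v - D / R * dist u v) 0 ≤ s.card := by
  rw [Finset.card_eq_sum_ones, Nat.cast_sum]
  refine Finset.sum_le_sum fun v _ => ?_
  have := sepWeight_le_one hw h1 f u v
  have : 0 ≤ D / R * dist u v := by positivity
  simp only [Nat.cast_one]
  exact max_le (by linarith) zero_le_one

/-- Each point lies in its own cluster: good when every point has few near neighbours. -/
theorem isLocalLabelling_id {R r D η : ℝ} (hR : 0 < R) (hr : 0 < r) (hD : 0 < D)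
    (hrD : r ≤ R / D) (A : X → ℝ) (U : Finset X)
    (hU : ∀ u ∈ U, ((U.filter fun v => dist u v ≤ R / D).card : ℝ) ≤ η * A u) :
    IsLocalLabelling R r D η A U (fun _ : Unit => (1 : ℝ)) fun _ v => v where
  pos _ := one_pos
  sum_eq := by simp
  mem _ _ hv := hv
  dist_le _ v _ := by simpa using hR.le
  average u hu := by
    have h := sum_max_sepWeight_le_card hR hD (w := fun _ : Unit => (1 : ℝ)) (fun _ => one_pos)
      (by simp) (fun _ v => v) (U.filter fun v => dist u v ≤ R / D) u
    have := distMass_nonneg hR U u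
    have : 0 ≤ 2 * Real.exp (-(D / 2)) * D * distMass R U u := by positivity
    linarith [hU u hu]
  worst _ u hu := by
    have h : ((U.filter fun v => dist u v ≤ r ∧ u ≠ v).card : ℝ) ≤
        (U.filter fun v => dist u v ≤ R / D).card := by
      exact_mod_cast Finset.card_le_card
        (Finset.monotone_filter_right U fun v _ (h : dist u v ≤ r ∧ u ≠ v) => h.1.trans hrD)
    have := distMass_nonneg hR U u
    have : 0 ≤ 16 * (r / R * D) * D * distMass R U u := by positivity
    linarith [hU u hu]

/-- Carving a random ball cluster around `z` and labelling the rest recursively. -/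
noncomputable def carveLabel (z : X) {I : Finset ℕ} (t : ℕ → ℝ) {κ : I → Type}
    (f : ∀ i, κ i → X → X) (x : Σ i, κ i) (v : X) : X :=
  if dist z v ≤ t x.1 then z else f x.1 x.2 v

/-- For a given radius, the pair is cut now, captured together (never separated), or passed on
intact to the recursion. -/
theorem sepWeight_carveLabel_le {z : X} {I : Finset ℕ} {p t : ℕ → ℝ}
    (hp : ∀ i ∈ I, 0 < p i) {κ : I → Type} [∀ i, Fintype (κ i)]
    {w : ∀ i, κ i → ℝ} {f : ∀ i, κ i → X → X} (hw : ∀ i j, 0 < w i j) (hw1 : ∀ i, ∑ j, w i j = 1)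
    (u v : X) :
    sepWeight (fun x : Σ i, κ i => p x.1 * w x.1 x.2) (carveLabel z t f) u v ≤
      ∑ i : I, (if ¬(dist z u ≤ t i ↔ dist z v ≤ t i) then p i else 0) +
      ∑ i : I, (if t i < dist z u ∧ t i < dist z v then p i * sepWeight (w i) (f i) u v else 0) := by
  unfold sepWeight
  rw [Fintype.sum_sigma, ← Finset.sum_add_distrib]
  refine Finset.sum_le_sum fun i _ => ?_
  have hpi := hp i i.2
  have htot : ∑ j, (if carveLabel z t f ⟨i, j⟩ u ≠ carveLabel z t f ⟨i, j⟩ v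
      then p i * w i j else 0) ≤ p i := by
    calc _ ≤ ∑ j, p i * w i j := by
          refine Finset.sum_le_sum fun j _ => ?_
          have := mul_pos hpi (hw i j)
          split_ifs
          · exact le_rfl
          · exact this.le
      _ = p i := by rw [← Finset.mul_sum, hw1, mul_one]
  by_cases h1 : dist z u ≤ t i <;> by_cases h2 : dist z v ≤ t i
  · simp [carveLabel, h1, h2, not_lt.2 h1]
  · simpa [h1, h2, not_lt.2 h1] using htot
  · simpa [h1, h2, not_lt.2 h2] using htot
  · simp only [carveLabel, h1, h2, if_false, not_le.1 h1, not_le.1 h2, and_self, if_true,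
      not_true_eq_false, zero_add, Finset.mul_sum, iff_self]
    refine Finset.sum_le_sum fun j _ => ?_
    split_ifs <;> simp

end Step

section Step

variable {X : Type*} [DecidableEq X] [MetricSpace X]

/-- Split the allowance a by whether the step captures u or v. The capture part cancels the main
term of `hsep`, the other part is passed to the recursion, and only c * a is lost. -/
theorem max_sepWeight_carveLabel_le {z : X} {I : Finset ℕ} {p t : ℕ → ℝ}
    (hp : ∀ i ∈ I, 0 < p i) (hp1 : ∑ i : I, p i = 1) {κ : I → Type} [∀ i, Fintype (κ i)]
    {w : ∀ i, κ i → ℝ} {f : ∀ i, κ i → X → X} (hw : ∀ i j, 0 < w i j) (hw1 : ∀ i, ∑ j, w i j = 1)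
    {u v : X} {a c : ℝ} (ha : 0 ≤ a) (hc : 0 ≤ c)
    (hsep : ∑ i : I, (if ¬(dist z u ≤ t i ↔ dist z v ≤ t i) then p i else 0) ≤
      a * (∑ i : I, (if dist z u ≤ t i ∨ dist z v ≤ t i then p i else 0) + c)) :
    max (sepWeight (fun x : Σ i, κ i => p x.1 * w x.1 x.2) (carveLabel z t f) u v - a) 0 ≤
      c * a + ∑ i : I, (if t i < dist z u ∧ t i < dist z v then
        p i * max (sepWeight (w i) (f i) u v - a) 0 else 0) := by
  have h := sepWeight_carveLabel_le (z := z) (t := t) (f := f) hp hw hw1 u v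
  have h0 : 0 ≤ ∑ i : I, (if t i < dist z u ∧ t i < dist z v then
        p i * max (sepWeight (w i) (f i) u v - a) 0 else 0) :=
    Finset.sum_nonneg fun i _ => by
      have := hp i i.2
      split_ifs
      · positivity
      · exact le_rfl
  refine max_le ?_ (add_nonneg (mul_nonneg hc ha) h0)
  have h1 : ∑ i : I, (if t i < dist z u ∧ t i < dist z v then
        p i * sepWeight (w i) (f i) u v else 0) ≤
      ∑ i : I, (if t i < dist z u ∧ t i < dist z v then
        p i * max (sepWeight (w i) (f i) u v - a) 0 else 0) +
      a * ∑ i : I, (if t i < dist z u ∧ t i < dist z v then p i else 0) := by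
    rw [Finset.mul_sum, ← Finset.sum_add_distrib]
    refine Finset.sum_le_sum fun i _ => ?_
    have hpi := hp i i.2
    split_ifs
    · have := le_max_left (sepWeight (w i) (f i) u v - a) 0
      nlinarith
    · simp
  have h2 : ∑ i : I, (if dist z u ≤ t i ∨ dist z v ≤ t i then p i else 0) +
      ∑ i : I, (if t i < dist z u ∧ t i < dist z v then p i else 0) = 1 := by
    rw [← Finset.sum_add_distrib, ← hp1]
    refine Finset.sum_congr rfl fun i _ => ?_
    by_cases hu : dist z u ≤ t i <;> by_cases hv : dist z v ≤ t i <;>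
      simp [hu, hv, not_lt.2, not_le.1]
  have h3 : a * ∑ i : I, (if dist z u ≤ t i ∨ dist z v ≤ t i then p i else 0) +
      a * ∑ i : I, (if t i < dist z u ∧ t i < dist z v then p i else 0) = a := by
    rw [← mul_add, h2, mul_one]
  linarith

/-- The average separation bound propagates through one carving step, given a per-step loss
proportional to `c`. -/
theorem sum_max_sepWeight_carveLabel_le {R D : ℝ} (hR : 0 < R) (hD : 0 < D) {U : Finset X} {z : X}
    {I : Finset ℕ} {p t : ℕ → ℝ}
    (hp : ∀ i ∈ I, 0 < p i) (hp1 : ∑ i : I, p i = 1) {κ : I → Type} [∀ i, Fintype (κ i)]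
    {w : ∀ i, κ i → ℝ} {f : ∀ i, κ i → X → X} (hw : ∀ i j, 0 < w i j) (hw1 : ∀ i, ∑ j, w i j = 1)
    {u : X} (hu : u ∈ U) {c K : ℝ} (hc : 0 ≤ c) (hK : 0 ≤ K)
    (hsep : ∀ v ∈ U, dist u v ≤ R / D →
      ∑ i : I, (if ¬(dist z u ≤ t i ↔ dist z v ≤ t i) then p i else 0) ≤
      D / R * dist u v * (∑ i : I, (if dist z u ≤ t i ∨ dist z v ≤ t i then p i else 0) + c))
    (hrec : ∀ i : I, u ∈ U \ U.filter (fun v => dist z v ≤ t i) →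
      ∑ v ∈ U \ U.filter (fun v => dist z v ≤ t i) with dist u v ≤ R / D,
        max (sepWeight (w i) (f i) u v - D / R * dist u v) 0 ≤ K) :
    ∑ v ∈ U with dist u v ≤ R / D, max (sepWeight (fun x : Σ i, κ i => p x.1 * w x.1 x.2)
        (carveLabel z t f) u v - D / R * dist u v) 0 ≤
      c * (U.filter fun v => dist u v ≤ R / D).card + K := by
  have hle : ∀ v ∈ U.filter (fun v => dist u v ≤ R / D),
      max (sepWeight (fun x : Σ i, κ i => p x.1 * w x.1 x.2)
        (carveLabel z t f) u v - D / R * dist u v) 0 ≤ c +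
        ∑ i : I, (if t i < dist z u ∧ t i < dist z v then
          p i * max (sepWeight (w i) (f i) u v - D / R * dist u v) 0 else 0) := fun v hv => by
    rw [Finset.mem_filter] at hv
    refine (max_sepWeight_carveLabel_le hp hp1 hw hw1 (by positivity) hc
      (hsep v hv.1 hv.2)).trans (add_le_add ?_ le_rfl)
    have : D / R * dist u v ≤ 1 := by
      calc D / R * dist u v ≤ D / R * (R / D) := by gcongr; exact hv.2
        _ = 1 := by field_simp
    nlinarith
  refine (Finset.sum_le_sum hle).trans ?_
  rw [Finset.sum_add_distrib, Finset.sum_const, nsmul_eq_mul, mul_comm c]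
  refine add_le_add le_rfl ?_
  rw [Finset.sum_comm]
  have hK1 : K = ∑ i : I, p i * K := by rw [← Finset.sum_mul, hp1, one_mul]
  rw [hK1]
  refine Finset.sum_le_sum fun i _ => ?_
  have hpi := hp i i.2
  by_cases hui : t i < dist z u
  · refine le_trans ?_ (mul_le_mul_of_nonneg_left (hrec i ?_) hpi.le)
    · rw [Finset.mul_sum, ← Finset.sum_filter]
      refine Finset.sum_le_sum_of_subset_of_nonneg ?_ fun _ _ _ => by positivity
      intro v hv
      simp only [Finset.mem_filter, Finset.mem_sdiff, not_and, not_le] at hv ⊢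
      exact ⟨⟨hv.1.1, fun _ => hv.2.2⟩, hv.1.2⟩
    · simp only [Finset.mem_filter, Finset.mem_sdiff, not_and, not_le]
      exact ⟨hu, fun _ => hui⟩
  · simp only [hui, false_and, if_false, Finset.sum_const_zero]
    positivity

/-- A stays fixed while U shrinks: light points stop paying through ηA(u), and heavy ones pay with
the mass of the removed cluster. -/
theorem IsLocalLabelling.carve {R r D η : ℝ} (hR : 0 < R) (hr : 0 < r) (hD : 16 ≤ D)
    (hrD : r / R * D ≤ 1 / 8) {A : X → ℝ} (hA : ∀ u, 0 ≤ η * A u) {U : Finset X} {z : X}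
    (hz : z ∈ U)
    (hmax : ∀ u ∈ U, η * A u < (U.filter fun v => dist u v ≤ R / D).card →
      (U.filter fun v => dist u v ≤ R / D).card ≤ (U.filter fun v => dist z v ≤ R / D).card)
    {I : Finset ℕ} {p t : ℕ → ℝ} (hp : ∀ i ∈ I, 0 < p i) (hp1 : ∑ i : I, p i = 1)
    (ht : ∀ i ∈ I, 3 * (R / D) ≤ t i ∧ t i ≤ R - r ∧
        ((U.filter fun v => dist z v ≤ t i + r).card : ℝ) -
          (U.filter fun v => dist z v ≤ t i - r).card ≤
            8 * (r / R * D) * (U.filter fun v => dist z v ≤ t i).card)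
    (hsep : ∀ u ∈ U, ∀ v ∈ U,
      ∑ i : I, (if ¬(dist z u ≤ t i ↔ dist z v ≤ t i) then p i else 0) ≤
      D / R * dist u v * (∑ i : I, (if dist z u ≤ t i ∨ dist z v ≤ t i then p i else 0) +
        2 * Real.exp (-(D / 2))))
    {κ : I → Type} [∀ i, Fintype (κ i)] {w : ∀ i, κ i → ℝ} {f : ∀ i, κ i → X → X}
    (hrec : ∀ i : I, IsLocalLabelling R r D η A (U \ U.filter fun v => dist z v ≤ t i)
      (w i) (f i)) :
    IsLocalLabelling R r D η A U (fun x : Σ i, κ i => p x.1 * w x.1 x.2) (carveLabel z t f) := by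
  have hD0 : 0 < D := by linarith
  have hρ : 0 < R / D := by positivity
  have hrρ : r ≤ R / D := by
    rw [div_mul_eq_mul_div, div_le_iff₀ hR] at hrD
    rw [le_div_iff₀ hD0]; linarith
  have hρ16 : R / D ≤ R / 16 := by gcongr
  have hpos : ∀ x : Σ i, κ i, 0 < p x.1 * w x.1 x.2 := fun x =>
    mul_pos (hp _ x.1.2) ((hrec _).pos _)
  have hsum : ∑ x : Σ i, κ i, p x.1 * w x.1 x.2 = 1 := by
    rw [Fintype.sum_sigma, ← hp1]
    refine Finset.sum_congr rfl fun i _ => ?_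
    dsimp only
    rw [← Finset.mul_sum, (hrec i).sum_eq, mul_one]
  have hmass := distMass_nonneg (X := X) hR
  have hmem : ∀ (x : Σ i, κ i), ∀ v ∈ U, ¬ dist z v ≤ t x.1 →
      v ∈ U \ U.filter fun v => dist z v ≤ t x.1 := fun x v hv hvt =>
    Finset.mem_sdiff.2 ⟨hv, fun h => hvt (Finset.mem_filter.1 h).2⟩
  refine ⟨hpos, hsum, ?_, ?_, ?_, ?_⟩
  · intro x v hv
    unfold carveLabel
    split_ifs with h
    · exact hz
    · exact (Finset.mem_sdiff.1 ((hrec x.1).mem x.2 v (hmem x v hv h))).1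
  · intro x v hv
    unfold carveLabel
    split_ifs with h
    · linarith [(ht x.1 x.1.2).2.1]
    · exact (hrec x.1).dist_le x.2 v (hmem x v hv h)
  · intro u hu
    have hexp : 0 ≤ 2 * Real.exp (-(D / 2)) := by positivity
    have hκ : 0 ≤ 2 * Real.exp (-(D / 2)) * D := by positivity
    rcases le_or_gt ((U.filter fun v => dist u v ≤ R / D).card : ℝ) (η * A u) with hl | hh
    · have := sum_max_sepWeight_le_card hR hD0 hpos hsum (carveLabel z t f)
        (U.filter fun v => dist u v ≤ R / D) u
      have := mul_nonneg hκ (hmass U u)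
      linarith
    have hcard := hmax u hu hh
    -- Since t ≥ 3R/D, such a u is captured together with its whole R/D-ball.
    rcases le_or_gt (dist z u) (2 * (R / D)) with hnear | hnear
    · have h0 : ∀ v ∈ U.filter (fun v => dist u v ≤ R / D),
          max (sepWeight (fun x : Σ i, κ i => p x.1 * w x.1 x.2)
            (carveLabel z t f) u v - D / R * dist u v) 0 = 0 := fun v hv => by
        rw [Finset.mem_filter] at hv
        have hs : sepWeight (fun x : Σ i, κ i => p x.1 * w x.1 x.2)
            (carveLabel z t f) u v = 0 := by
          refine Finset.sum_eq_zero fun x _ => if_neg ?_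
          have h3 := (ht x.1 x.1.2).1
          have hu' : dist z u ≤ t x.1 := by linarith
          have hv' : dist z v ≤ t x.1 := by linarith [dist_triangle z u v, hv.2]
          simp [carveLabel, hu', hv']
        rw [hs, max_eq_right]
        have : 0 ≤ D / R * dist u v := by positivity
        linarith
      rw [Finset.sum_eq_zero h0]
      have := mul_nonneg hκ (hmass U u)
      linarith [hA u]
    -- Beyond R + R/D neither u nor its near neighbours can be captured, so the step loses nothing
    -- (c = 0). In between, the core pays.
    rcases le_or_gt (dist z u) (R + R / D) with hrel | hirr
    · set core := U.filter fun v => dist z v ≤ R / D with hcore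
      have hcoreMass : ∀ i : I, (core.card : ℝ) ≤
          D * distMass R (U.filter fun v => dist z v ≤ t i) u := fun i => by
        refine card_le_mul_distMass hR hD0 _ core u (fun v hv => ?_) fun v hv => ?_
        · rw [hcore, Finset.mem_filter] at hv
          exact Finset.mem_filter.2 ⟨hv.1, by linarith [hv.2, (ht i i.2).1]⟩
        · rw [hcore, Finset.mem_filter] at hv
          constructor
          · linarith [dist_triangle_right z u v, hv.2]
          · linarith [dist_triangle_left u v z, hv.2]
      have hstep : ∀ i : I,
          η * A u + 2 * Real.exp (-(D / 2)) * D *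
            distMass R (U \ U.filter fun v => dist z v ≤ t i) u ≤
          η * A u + 2 * Real.exp (-(D / 2)) * (D * distMass R U u - core.card) := fun i => by
        have h1 := distMass_add_sdiff R (Finset.filter_subset (fun v => dist z v ≤ t i) U) u
        have h2 : D * distMass R (U \ U.filter fun v => dist z v ≤ t i) u ≤
            D * distMass R U u - core.card := by
          rw [← h1, mul_add]; linarith [hcoreMass i]
        rw [mul_assoc]
        linarith [mul_le_mul_of_nonneg_left h2 hexp]
      have hne : Nonempty I := by
        by_contra h
        rw [not_nonempty_iff] at h
        simp at hp1
      obtain ⟨i₀⟩ := hne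
      -- Nonnegativity of the reduced budget is read off from any one radius.
      have hK := (hstep i₀).trans' (add_nonneg (hA u) (mul_nonneg hκ (hmass _ u)))
      refine (sum_max_sepWeight_carveLabel_le hR hD0 hp hp1 (fun i => (hrec i).pos)
        (fun i => (hrec i).sum_eq) hu hexp hK (fun v hv _ => hsep u hu v hv)
        fun i hi => ((hrec i).average u hi).trans (hstep i)).trans ?_
      have : ((U.filter fun v => dist u v ≤ R / D).card : ℝ) ≤ core.card := by
        exact_mod_cast hcard
      nlinarith
    · have hstep : ∀ i : I,
          η * A u + 2 * Real.exp (-(D / 2)) * D *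
            distMass R (U \ U.filter fun v => dist z v ≤ t i) u ≤
          η * A u + 2 * Real.exp (-(D / 2)) * D * distMass R U u := fun i => by
        have h1 := distMass_add_sdiff R (Finset.filter_subset (fun v => dist z v ≤ t i) U) u
        have h2 := hmass (U.filter fun v => dist z v ≤ t i) u
        gcongr
        linarith
      have h := sum_max_sepWeight_carveLabel_le hR hD0 hp hp1 (fun i => (hrec i).pos)
        (fun i => (hrec i).sum_eq) hu le_rfl (add_nonneg (hA u) (mul_nonneg hκ (hmass U u)))
        (fun v hv hvu => ?_) fun i hi => ((hrec i).average u hi).trans (hstep i)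
      · linarith
      · rw [Finset.sum_eq_zero]
        · refine mul_nonneg (by positivity) (add_nonneg (Finset.sum_nonneg fun i _ => ?_) le_rfl)
          have := hp i i.2
          split_ifs
          · exact this.le
          · exact le_rfl
        · intro i _
          have h3 := (ht i i.2).2.1
          have hu' : ¬ dist z u ≤ t i := by linarith
          have hv' : ¬ dist z v ≤ t i := by linarith [dist_triangle_right z u v]
          simp [hu', hv']
  · intro x u hu
    have hκ : 0 ≤ 16 * (r / R * D) * D := by positivity
    rcases le_or_gt ((U.filter fun v => dist u v ≤ R / D).card : ℝ) (η * A u) with hl | hh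
    · have : ((U.filter fun v => dist u v ≤ r ∧ carveLabel z t f x u ≠ carveLabel z t f x v).card :
          ℝ) ≤ (U.filter fun v => dist u v ≤ R / D).card := by
        exact_mod_cast Finset.card_le_card (Finset.monotone_filter_right U
          fun v _ (h : dist u v ≤ r ∧ _) => h.1.trans hrρ)
      have := mul_nonneg hκ (hmass U u)
      linarith
    have hcard := hmax u hu hh
    obtain ⟨i, j⟩ := x
    obtain ⟨ht1, ht2, ht3⟩ := ht i i.2
    set Q := U.filter fun v => dist z v ≤ t i with hQ
    have hQU : Q ⊆ U := Finset.filter_subset _ _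
    have hsplit := distMass_add_sdiff R hQU u
    -- Sparsity gives 8βD times the cluster size, and the core argument a further 2D times the mass:
    -- hence 16.
    have hannulus : t i - r < dist z u → dist z u ≤ t i + r →
        (((U.filter fun v => dist z v ≤ t i + r) \ U.filter fun v => dist z v ≤ t i - r).card : ℝ)
          ≤ 16 * (r / R * D) * D * distMass R Q u := fun h1 h2 => by
      have h3 := card_cluster_le_mul_distMass hR hr hD0 hrρ U z u (t i) ht1 ht2 hcard h1 h2
      rw [Finset.cast_card_sdiff (Finset.monotone_filter_right U fun v _ h => by linarith)]
      refine ht3.trans ?_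
      have h4 : 0 ≤ 8 * (r / R * D) := by positivity
      nlinarith [mul_le_mul_of_nonneg_left h3 h4]
    have hcut : ∀ V : Finset X, V ⊆ U → (∀ v ∈ V, dist u v ≤ r ∧
        ¬(dist z u ≤ t i ↔ dist z v ≤ t i)) →
        (V.card : ℝ) ≤ 16 * (r / R * D) * D * distMass R Q u := fun V hVU hV => by
      rcases V.eq_empty_or_nonempty with rfl | ⟨v₀, hv₀⟩
      · simpa using mul_nonneg hκ (hmass Q u)
      have hb : ∀ v ∈ V, (t i - r < dist z u ∧ dist z u ≤ t i + r) ∧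
          t i - r < dist z v ∧ dist z v ≤ t i + r := fun v hv => by
        obtain ⟨hd, hs⟩ := hV v hv
        have := dist_triangle z u v
        have := dist_triangle_right z u v
        by_cases h1 : dist z u ≤ t i <;> by_cases h2 : dist z v ≤ t i
        · exact absurd (iff_of_true h1 h2) hs
        · refine ⟨⟨?_, ?_⟩, ?_, ?_⟩ <;> linarith
        · refine ⟨⟨?_, ?_⟩, ?_, ?_⟩ <;> linarith
        · exact absurd (iff_of_false h1 h2) hs
      refine le_trans ?_ (hannulus (hb v₀ hv₀).1.1 (hb v₀ hv₀).1.2)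
      have : V ⊆ (U.filter fun v => dist z v ≤ t i + r) \
          U.filter fun v => dist z v ≤ t i - r := fun v hv => by
        simp only [Finset.mem_sdiff, Finset.mem_filter, not_and, not_le]
        exact ⟨⟨hVU hv, (hb v hv).2.2⟩, fun _ => (hb v hv).2.1⟩
      exact_mod_cast Finset.card_le_card this
    by_cases hut : dist z u ≤ t i
    · have h := hcut (U.filter fun v => dist u v ≤ r ∧
        carveLabel z t f ⟨i, j⟩ u ≠ carveLabel z t f ⟨i, j⟩ v) (Finset.filter_subset _ _)
        fun v hv => by
          rw [Finset.mem_filter] at hv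
          refine ⟨hv.2.1, fun hiff => hv.2.2 ?_⟩
          simp [carveLabel, hut, hiff.1 hut]
      have h1 := mul_nonneg hκ (hmass (U \ Q) u)
      rw [← hsplit, mul_add]
      linarith [hA u]
    · have h := hcut (U.filter fun v => dist u v ≤ r ∧ dist z v ≤ t i) (Finset.filter_subset _ _)
        fun v hv => by
          rw [Finset.mem_filter] at hv
          exact ⟨hv.2.1, fun hiff => hut (hiff.2 hv.2.2)⟩
      have h' := (hrec i).worst j u (hmem ⟨i, j⟩ u hu hut)
      have hsub : (U.filter fun v => dist u v ≤ r ∧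
          carveLabel z t f ⟨i, j⟩ u ≠ carveLabel z t f ⟨i, j⟩ v) ⊆
          (U.filter fun v => dist u v ≤ r ∧ dist z v ≤ t i) ∪
          ((U \ Q).filter fun v => dist u v ≤ r ∧ f i j u ≠ f i j v) := fun v hv => by
        rw [Finset.mem_filter] at hv
        by_cases hvt : dist z v ≤ t i
        · exact Finset.mem_union_left _ (Finset.mem_filter.2 ⟨hv.1, hv.2.1, hvt⟩)
        · refine Finset.mem_union_right _ (Finset.mem_filter.2
            ⟨hmem ⟨i, j⟩ v hv.1 hvt, hv.2.1, ?_⟩)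
          simpa [carveLabel, hut, hvt] using hv.2.2
      have hc : ((U.filter fun v => dist u v ≤ r ∧
          carveLabel z t f ⟨i, j⟩ u ≠ carveLabel z t f ⟨i, j⟩ v).card : ℝ) ≤
          (U.filter fun v => dist u v ≤ r ∧ dist z v ≤ t i).card +
          ((U \ Q).filter fun v => dist u v ≤ r ∧ f i j u ≠ f i j v).card := by
        exact_mod_cast (Finset.card_le_card hsub).trans (Finset.card_union_le _ _)
      rw [← hsplit, mul_add]
      linarith

/-- Every subset has a local labelling, provided dense points have bounded growth. -/
theorem exists_isLocalLabelling {R r D η : ℝ} (hR : 0 < R) (hr : 0 < r) (hD : 16 ≤ D)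
    (hrD : r / R * D ≤ 1 / 8) {A : X → ℝ} (hA : ∀ u, 0 ≤ η * A u)
    (hgrow : ∀ (U : Finset X) (z : X),
      η * A z < (U.filter fun v => dist z v ≤ R / D).card →
      ((U.filter fun v => dist z v ≤ R).card : ℝ) ≤
        Real.exp (D / 2) * (U.filter fun v => dist z v ≤ R / D).card) (U : Finset X) :
    ∃ (ι : Type) (_ : Fintype ι) (w : ι → ℝ) (f : ι → X → X),
      IsLocalLabelling R r D η A U w f := by
  have hD0 : 0 < D := by linarith
  have hρ : 0 < R / D := by positivity
  induction U using Finset.strongInduction with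
  | H U ih =>
    set H := U.filter fun u => η * A u < (U.filter fun v => dist u v ≤ R / D).card with hH
    rcases H.eq_empty_or_nonempty with hE | hN
    · refine ⟨Unit, inferInstance, _, _, isLocalLabelling_id hR hr hD0 ?_ A U fun u hu => ?_⟩
      · rw [div_mul_eq_mul_div, div_le_iff₀ hR] at hrD
        rw [le_div_iff₀ hD0]; linarith
      · by_contra h
        have : u ∈ H := Finset.mem_filter.2 ⟨hu, not_le.1 h⟩
        simp [hE] at this
    · obtain ⟨z, hzH, hzmax⟩ :=
        H.exists_max_image (fun u => (U.filter fun v => dist u v ≤ R / D).card) hN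
      obtain ⟨hz, hzheavy⟩ := Finset.mem_filter.1 hzH
      obtain ⟨I, p, t, hp, hp1, ht, hsep⟩ :=
        exists_radius_law U z hz R r D hR hr hD hrD (hgrow U z hzheavy)
      have hssub : ∀ i : I, U \ U.filter (fun v => dist z v ≤ t i) ⊂ U := fun i => by
        refine Finset.sdiff_ssubset (Finset.filter_subset _ _) ⟨z, Finset.mem_filter.2 ⟨hz, ?_⟩⟩
        rw [dist_self]; linarith [(ht i i.2).1]
      choose κ hκ w f hrec using fun i : I => ih _ (hssub i)
      refine ⟨Σ i, κ i, inferInstance, _, _, IsLocalLabelling.carve hR hr hD hrD hA hz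
        (fun u hu hh => hzmax u (Finset.mem_filter.2 ⟨hu, hh⟩)) hp ?_ ht (fun u hu v hv => ?_) hrec⟩
      · rw [← hp1, ← Finset.sum_coe_sort I]
      · have h := hsep u hu v hv
        rw [Finset.sum_filter, Finset.sum_filter, ← Finset.sum_coe_sort I,
          ← Finset.sum_coe_sort I] at h
        exact h

end Step

/-! ### From labellings to random partitions. -/

section Conversion

variable {X : Type*} [Fintype X] [DecidableEq X]

/-- The clustering whose clusters are the fibres of a labelling. -/
noncomputable def fiberClustering (f : X → X) : Clustering X :=
  Finpartition.ofSetoid (Setoid.ker f)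

theorem mem_part_fiberClustering (f : X → X) (u v : X) :
    v ∈ (fiberClustering f).part u ↔ f u = f v := by
  unfold fiberClustering
  rw [Finpartition.mem_part_ofSetoid_iff_rel]
  rfl

theorem separates_fiberClustering (f : X → X) (u v : X) :
    Separates (fiberClustering f) u v ↔ f u ≠ f v := by
  rw [Separates, ne_eq, ne_eq, ← Finpartition.mem_part_iff_part_eq_part _ (Finset.mem_univ u)
    (Finset.mem_univ v), mem_part_fiberClustering, eq_comm]

theorem separationProb_map_fiberClustering {ι : Type} [Fintype ι] {w : ι → ℝ} (hw : ∀ i, 0 < w i)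
    (h1 : ∑ i, ENNReal.ofReal (w i) = 1) (f : ι → X → X) (u v : X) :
    separationProb ((PMF.ofFintype (fun i => ENNReal.ofReal (w i)) h1).map
      fun i => fiberClustering (f i)) u v = sepWeight w f u v := by
  unfold separationProb sepWeight
  rw [PMF.toOuterMeasure_map_apply, PMF.toOuterMeasure_ofFintype_apply, tsum_fintype,
    ENNReal.toReal_sum]
  · refine Finset.sum_congr rfl fun i _ => ?_
    by_cases h : f i u = f i v
    · rw [Set.indicator_of_notMem]
      · simp [h]
      · simp [separates_fiberClustering, h]
    · rw [Set.indicator_of_mem]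
      · simp [h, (hw i).le]
      · simp [separates_fiberClustering, h]
  · intro i _
    classical
    rw [Set.indicator_apply]
    split_ifs <;> simp

end Conversion

theorem diam_le_of_mem_fiberClustering {X : Type*} [Fintype X] [DecidableEq X] [MetricSpace X]
    {R : ℝ} (hR : 0 ≤ R) {f : X → X} (hf : ∀ v, dist (f v) v ≤ R) {p : Finset X}
    (hp : p ∈ (fiberClustering f).parts) : Metric.diam (p : Set X) ≤ 2 * R := by
  refine Metric.diam_le_of_forall_dist_le (by linarith) fun u hu v hv => ?_
  have h1 := Finpartition.part_eq_of_mem _ hp hu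
  have h2 : f u = f v := by
    rw [← mem_part_fiberClustering, h1]; exact hv
  have h3 := hf v
  rw [← h2] at h3
  linarith [dist_triangle_left u v (f u), hf u]

/-! ### Numerical thresholds and assembly. -/

theorem le_and_mul_sepCoeff_le {q β : ℝ} (hq : 1 ≤ q) (hβ : 0 < β)
    (h : β ≤ 1 / 1000 * (1 / (q * Real.log (q + 1)))) :
    β ≤ 1 / 600 ∧ 16 ≤ sepCoeff q β ∧ β * sepCoeff q β ≤ 1 / 8 := by
  have hl : 0.6 ≤ Real.log (q + 1) := by
    have : Real.log 2 ≤ Real.log (q + 1) := Real.log_le_log (by norm_num) (by linarith)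
    linarith [Real.log_two_gt_d9]
  set l := Real.log (q + 1) with hldef
  have hl0 : 0 < l := by linarith
  have hq0 : 0 < q := by linarith
  set B := 1 / 1000 * (1 / (q * l)) with hB
  have hB0 : 0 < B := by positivity
  have hB600 : B ≤ 1 / 600 := by
    have : 1 / (q * l) ≤ 1 / 0.6 := by gcongr; nlinarith
    rw [hB]; norm_num at this ⊢; linarith
  have hsc : sepCoeff q β = 2 * (q + 1) * -Real.log β := by
    rw [sepCoeff, one_div, Real.log_inv]
  have he4 : Real.exp 4 ≤ 600 := by
    have h4 : Real.exp 4 = Real.exp 1 ^ 4 := by rw [← Real.exp_nat_mul]; norm_num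
    rw [h4]
    calc Real.exp 1 ^ 4 ≤ 2.7182818286 ^ 4 := by gcongr; exact Real.exp_one_lt_d9.le
      _ ≤ 600 := by norm_num
  have hlog4 : ∀ x : ℝ, 0 < x → x ≤ 1 / 600 → 4 ≤ -Real.log x := fun x hx hx' => by
    rw [← Real.log_inv, Real.le_log_iff_exp_le (inv_pos.2 hx)]
    refine he4.trans ?_
    rw [le_inv_comm₀ (by norm_num) hx]
    linarith
  refine ⟨h.trans hB600, ?_, ?_⟩
  · rw [hsc]
    nlinarith [hlog4 β hβ (h.trans hB600)]
  -- This replaces monotonicity of x ln(1/x): it yields β ln(1/β) ≤ B(1 + ln(1/B)), so only the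
  -- threshold B needs estimating.
  · have hy : -Real.log (β / B) ≤ (β / B)⁻¹ - 1 := by
      linarith [Real.one_sub_inv_le_log_of_pos (div_pos hβ hB0)]
    rw [Real.log_div hβ.ne' hB0.ne', inv_div] at hy
    have h1 : β * -Real.log β ≤ B * (1 - Real.log B) := by
      have h2 := mul_le_mul_of_nonneg_left hy hβ.le
      have h3 : β * (B / β - 1) = B - β := by field_simp
      nlinarith [hlog4 B hB0 hB600]
    have he7 : Real.log 1000 ≤ 7 := by
      rw [Real.log_le_iff_le_exp (by norm_num)]
      have h7 : Real.exp 7 = Real.exp 1 ^ 7 := by rw [← Real.exp_nat_mul]; norm_num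
      rw [h7]
      calc (1000 : ℝ) ≤ 2.7182818283 ^ 7 := by norm_num
        _ ≤ Real.exp 1 ^ 7 := by gcongr; exact Real.exp_one_gt_d9.le
    have hlogB : -Real.log B ≤ 6 + 2 * l := by
      have e : B = (1000 * (q * l))⁻¹ := by rw [hB]; field_simp
      rw [e, Real.log_inv, neg_neg, Real.log_mul (by norm_num) (by positivity),
        Real.log_mul hq0.ne' hl0.ne']
      have h2 : Real.log q ≤ l := Real.log_le_log hq0 (by linarith)
      have h3 := Real.log_le_sub_one_of_pos hl0
      linarith
    have h4 : 2 * (q + 1) * B ≤ 1 / 250 / l := by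
      have : (q + 1) / q ≤ 2 := by rw [div_le_iff₀ hq0]; linarith
      calc 2 * (q + 1) * B = (q + 1) / q * (1 / 500 / l) := by rw [hB]; field_simp; norm_num
        _ ≤ 2 * (1 / 500 / l) := by gcongr
        _ = _ := by ring
    calc β * sepCoeff q β = 2 * (q + 1) * (β * -Real.log β) := by rw [hsc]; ring
      _ ≤ 2 * (q + 1) * (B * (1 - Real.log B)) := by gcongr
      _ = 2 * (q + 1) * B * (1 - Real.log B) := by ring
      _ ≤ 1 / 250 / l * (7 + 2 * l) := by
        gcongr
        · linarith [hlog4 B hB0 hB600]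
        · linarith
      _ ≤ 1 / 8 := by
        rw [div_mul_eq_mul_div, div_le_iff₀ hl0]; linarith

/-- A random local clustering of a finite metric space, with explicit constants. -/
theorem exists_local_clustering {X : Type*} [Fintype X] [DecidableEq X] [MetricSpace X]
    {q r R : ℝ} (hq : 1 ≤ q) (hr : 0 < r) (hR : 0 < R) (hβ : r / R ≤ 1 / 600)
    (hD : 16 ≤ sepCoeff q (r / R)) (hrD : r / R * sepCoeff q (r / R) ≤ 1 / 8) :
    ∃ (ι : Type) (_ : Fintype ι) (w : ι → ℝ) (f : ι → X → X),
      (∀ i, 0 < w i) ∧ ∑ i, w i = 1 ∧ (∀ i v, dist (f i v) v ≤ R) ∧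
      (∀ u, ∑ v ∈ finBall u (R / sepCoeff q (r / R)),
        max (sepWeight w f u v - sepCoeff q (r / R) * (dist u v / R)) 0 ≤
          2 * ((r / R) ^ q * ∑ v ∈ finBall u (2 * R), dist u v / R)) ∧
      ∀ i u, (((finBall u r).filter fun v => f i u ≠ f i v).card : ℝ) ≤
        17 * ((r / R) * sepCoeff q (r / R) ^ 2 * ∑ v ∈ finBall u (2 * R), dist u v / R) := by
  have hβ0 : 0 < r / R := by positivity
  set β := r / R with hβdef
  have hDdef : Real.exp (-(sepCoeff q β / 2)) = β ^ q * β := by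
    rw [← Real.rpow_add_one hβ0.ne', Real.rpow_def_of_pos hβ0, sepCoeff, one_div, Real.log_inv]
    ring_nf
  set D := sepCoeff q β with hDD
  set η := β ^ q with hη
  have hη0 : 0 < η := Real.rpow_pos_of_pos hβ0 q
  have hηβ : η ≤ β := by
    simpa using Real.rpow_le_rpow_of_exponent_ge hβ0 (by linarith) hq
  have hD0 : 0 < D := by linarith
  have hmass := distMass_nonneg (X := X) hR Finset.univ
  have hexp : Real.exp (D / 2) * (η * β) = 1 := by
    rw [← hDdef, ← Real.exp_add, add_neg_cancel, Real.exp_zero]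
  obtain ⟨ι, hι, w, f, h⟩ := exists_isLocalLabelling (X := X) (η := η)
    (A := distMass R Finset.univ) hR hr hD hrD (fun u => mul_nonneg hη0.le (hmass u))
    -- Growth of heavy balls: the annulus has at most D A(z) < D N₀/η points, and e^{D/2} ηβ = 1
    -- with βD ≤ 1/8 absorbs this.
    (fun U z hz => by
      have h1 := card_le_mul_distMass hR hD0 Finset.univ
        ((U.filter fun v => dist z v ≤ R) \ U.filter fun v => dist z v ≤ R / D) z
        (Finset.subset_univ _) fun v hv => by
          simp only [Finset.mem_sdiff, Finset.mem_filter, not_and, not_le] at hv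
          exact ⟨(hv.2 hv.1.1).le, by linarith [hv.1.2]⟩
      rw [Finset.cast_card_sdiff (Finset.monotone_filter_right U fun v _
        (hv : dist z v ≤ R / D) => hv.trans (div_le_self hR.le (by linarith)))] at h1
      set N := ((U.filter fun v => dist z v ≤ R).card : ℝ)
      set N₀ := ((U.filter fun v => dist z v ≤ R / D).card : ℝ)
      have hN₀ : 0 ≤ N₀ := Nat.cast_nonneg _
      have h2 : N * (η * β) ≤ N₀ := by
        have h3 : N * (η * β) ≤ (D * distMass R Finset.univ z + N₀) * (η * β) := by
          gcongr; linarith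
        have h4 : D * distMass R Finset.univ z * (η * β) ≤ N₀ * (1 / 8) := by
          calc _ = η * distMass R Finset.univ z * (β * D) := by ring
            _ ≤ N₀ * (1 / 8) := by gcongr
        have h5 : N₀ * (η * β) ≤ N₀ * (1 / 2) := by gcongr; nlinarith
        linarith
      calc N = Real.exp (D / 2) * (N * (η * β)) := by linear_combination -N * hexp
        _ ≤ Real.exp (D / 2) * N₀ := by gcongr) Finset.univ
  have hmassEq : ∀ u : X, ∑ v ∈ finBall u (2 * R), dist u v / R = distMass R Finset.univ u :=
    fun _ => rfl
  refine ⟨ι, hι, w, f, h.pos, h.sum_eq, fun i v => h.dist_le i v (Finset.mem_univ _), ?_, ?_⟩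
  · intro u
    have h1 := h.average u (Finset.mem_univ _)
    rw [hDdef] at h1
    have h2 : 2 * (η * β) * D * distMass R Finset.univ u ≤ η * distMass R Finset.univ u := by
      have := mul_nonneg hη0.le (hmass u)
      nlinarith
    rw [hmassEq]
    have h3 : ∑ v ∈ finBall u (R / D), max (sepWeight w f u v - D * (dist u v / R)) 0 =
        ∑ v ∈ Finset.univ with dist u v ≤ R / D,
          max (sepWeight w f u v - D / R * dist u v) 0 :=
      Finset.sum_congr rfl fun v _ => by rw [mul_div_assoc', div_mul_eq_mul_div]
    rw [h3]
    linarith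
  · intro i u
    have h1 := h.worst i u (Finset.mem_univ _)
    have h2 : η * distMass R Finset.univ u ≤ β * D ^ 2 * distMass R Finset.univ u := by
      refine mul_le_mul_of_nonneg_right ?_ (hmass u)
      exact hηβ.trans (le_mul_of_one_le_right hβ0.le (one_le_pow₀ (by linarith)))
    rw [hmassEq, finBall, Finset.filter_filter]
    rw [← hβdef] at h1
    linarith

open Classical in
theorem theorem3 :
    -- the threshold function `q ↦ β*_q` and absolute constants
    ∃ βstar : ℝ → ℝ, ∃ c₁ c₂ C : ℝ, 0 < c₁ ∧ 0 < c₂ ∧ 0 < C ∧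
      ∀ q : ℝ, 1 ≤ q →
        -- `β*_q = Θ(1 / (q ln (q + 1)))` and `β*_q < 1`
        c₁ * (1 / (q * Real.log (q + 1))) ≤ βstar q ∧
        βstar q ≤ c₂ * (1 / (q * Real.log (q + 1))) ∧
        βstar q < 1 ∧
        ∀ (X : Type*) [Fintype X] [MetricSpace X] (r R : ℝ), 0 < r → 0 < R →
          r / R ≤ βstar q →
          ∃ μ : PMF (Clustering X),
            -- every cluster always has diameter at most `2R`
            (∀ P ∈ μ.support, ∀ p ∈ P.parts, Metric.diam (p : Set X) ≤ 2 * R) ∧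
            -- separation on average
            (∀ u : X,
              ∑ v ∈ finBall u R,
                  (separationProb μ u v - sepCoeff q (r / R) * (dist u v / R))⁺
                ≤ C * ((r / R) ^ q * ∑ v ∈ finBall u (2 * R), dist u v / R)) ∧
            -- separation in the worst case
            (∀ P ∈ μ.support, ∀ u : X,
              ∑ v ∈ finBall u r, (if Separates P u v then (1 : ℝ) else 0)
                ≤ C * ((r / R) * sepCoeff q (r / R) ^ 2 *
                    ∑ v ∈ finBall u (2 * R), dist u v / R)) := by
  -- C = 17 is 16 from the annuli plus 1 from light points, where β^q ≤ βD².
  refine ⟨fun q => 1 / 1000 * (1 / (q * Real.log (q + 1))), 1 / 1000, 1 / 1000, 17,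
    by norm_num, by norm_num, by norm_num, fun q hq => ⟨le_rfl, le_rfl, ?_, ?_⟩⟩
  · have hl := Real.log_pos (by linarith : 1 < q + 1)
    exact (le_and_mul_sepCoeff_le hq (by positivity) le_rfl).1.trans_lt (by norm_num)
  · intro X _ _ r R hr hR hβ
    have hβ0 : 0 < r / R := by positivity
    obtain ⟨h1, hD, hrD⟩ := le_and_mul_sepCoeff_le hq hβ0 hβ
    obtain ⟨ι, _, w, f, hw, hw1, hdist, havg, hworst⟩ :=
      exists_local_clustering (X := X) hq hr hR h1 hD hrD
    have hw1' : ∑ i, ENNReal.ofReal (w i) = 1 := by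
      rw [← ENNReal.ofReal_sum_of_nonneg fun i _ => (hw i).le, hw1, ENNReal.ofReal_one]
    have hsupp : ∀ P ∈ ((PMF.ofFintype (fun i => ENNReal.ofReal (w i)) hw1').map
        fun i => fiberClustering (f i)).support, ∃ i, P = fiberClustering (f i) := fun P hP => by
      rw [PMF.mem_support_map_iff] at hP
      obtain ⟨i, _, hi⟩ := hP
      exact ⟨i, hi.symm⟩
    have hmass : ∀ u : X, 0 ≤ ∑ v ∈ finBall u (2 * R), dist u v / R := fun u =>
      Finset.sum_nonneg fun _ _ => by positivity
    refine ⟨(PMF.ofFintype (fun i => ENNReal.ofReal (w i)) hw1').map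
      fun i => fiberClustering (f i), ?_, ?_, ?_⟩
    · intro P hP p hp
      obtain ⟨i, rfl⟩ := hsupp P hP
      exact diam_le_of_mem_fiberClustering hR.le (hdist i) hp
    · intro u
      simp only [separationProb_map_fiberClustering hw hw1' f, posPart_def]
      have hη : 0 ≤ (r / R) ^ q := Real.rpow_nonneg hβ0.le q
      -- Beyond R/D the linear term exceeds 1, so the positive part vanishes.
      have hle : ∑ v ∈ finBall u R,
          max (sepWeight w f u v - sepCoeff q (r / R) * (dist u v / R)) 0 ≤
          ∑ v ∈ finBall u (R / sepCoeff q (r / R)),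
            max (sepWeight w f u v - sepCoeff q (r / R) * (dist u v / R)) 0 := by
        refine (Finset.sum_subset (Finset.monotone_filter_right _ fun v _ hv =>
          le_trans hv (div_le_self hR.le (by linarith))) fun v _ hv => ?_).ge
        simp only [Finset.mem_filter, not_and, not_le] at hv
        have h2 := hv (Finset.mem_univ _)
        rw [div_lt_iff₀ (by linarith)] at h2
        apply max_eq_right
        have h3 : 1 ≤ sepCoeff q (r / R) * (dist u v / R) := by
          rw [mul_div_assoc', le_div_iff₀ hR]; linarith
        linarith [sepWeight_le_one hw hw1 f u v]
      have := mul_nonneg hη (hmass u)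
      exact (hle.trans (havg u)).trans (by linarith)
    · intro P hP u
      obtain ⟨i, rfl⟩ := hsupp P hP
      refine le_trans (le_of_eq ?_) (hworst i u)
      rw [Finset.sum_boole]
      simp only [separates_fiberClustering]
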